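/- All graphs are finite, simple and undirected. A leaf of a tree is a vertex of degree at most $1$ (so the vertex of a one-vertex tree is a leaf). A graph $G=(V,E)$ is a $3$-leaf power if there is a finite tree $T$ whose leaves are in bijection with $V$ such that two distinct vertices of $G$ are adjacent iff the corresponding leaves are at distance at most $3$ in $T$. Write $N(v)$ for the set of neighbors of a vertex $v$. A set $S\subseteq V$ is a module of $G$ if $N(x)\setminus S=N(y)\setminus S$ for all $x,y\in S$. A critical clique of $G$ is a clique that is a module and is inclusion-maximal among the cliques that are modules. Given graphs $G_1=(V_1,E_1)$ and $G_2=(V_2,E_2)$ with $V_1\cap V_2=\emptyset$, and nonempty sets $S_1\subseteq V_1$, $S_2\subseteq V_2$, the join composition $(G_1,S_1)\otimes(G_2,S_2)$ is the graph with vertex set $V_1\cup V_2$ whose edges are those of $E_1$, those of $E_2$, and all pairs $\{x,y\}$ with $x\in S_1$, $y\in S_2$. **Theorem.** Let $G_1=(V_1,E_1)$ and $G_2=(V_2,E_2)$ be two disjoint connected $3$-leaf powers and let $S_1\subseteq V_1$, $S_2\subseteq V_2$ be nonempty. Then $(G_1,S_1)\otimes(G_2,S_2)$ is a $3$-leaf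 power if and only if one of the following conditions holds: 1. $S_1$ is a clique of $G_1$, $S_2$ is a clique of $G_2$, and for each $i\in\{1,2\}$, if $S_i$ is not a critical clique of $G_i$, then $G_i$ is a complete graph. 2. Up to exchanging the roles of $(G_1,S_1)$ and $(G_2,S_2)$, there is a vertex $v\in V_1$ such that $S_1=N(v)\cup\{v\}$, and $S_2=V_2$ is a clique of $G_2$. -/

import Mathlib

namespace LeafPower

/-- A leaf of a tree: a vertex with at most one neighbor (so the vertex of the one-vertex tree is
a leaf). -/
def IsLeaf {W : Type*} (T : SimpleGraph W) (w : W) : Prop :=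
  (T.neighborSet w).Subsingleton

/-- The `k`-leaf power of `T`: the graph on the leaves of `T` in which two distinct leaves are
adjacent iff their distance in `T` is at most `k`. -/
def leafPower {W : Type*} (T : SimpleGraph W) (k : ℕ) : SimpleGraph {w : W // IsLeaf T w} where
  Adj a b := a ≠ b ∧ T.dist a.1 b.1 ≤ k
  symm := ⟨fun _ _ h => ⟨h.1.symm, by rw [SimpleGraph.dist_comm]; exact h.2⟩⟩
  loopless := ⟨fun _ h => h.1 rfl⟩

/-- `G` is a `k`-leaf power: up to a bijection between its vertices and the leaves, it is the
`k`-leaf power of some finite tree. -/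
def IsLeafPower {V : Type*} (G : SimpleGraph V) (k : ℕ) : Prop :=
  ∃ (W : Type) (_ : Finite W) (T : SimpleGraph W), T.IsTree ∧ Nonempty (G ≃g leafPower T k)

/-- A module: any two vertices of `S` have the same neighbors outside `S`. -/
def IsModule {V : Type*} (G : SimpleGraph V) (S : Set V) : Prop :=
  ∀ x ∈ S, ∀ y ∈ S, G.neighborSet x \ S = G.neighborSet y \ S

/-- A critical clique: a clique which is a module and is inclusion-maximal with this property. -/
def IsCriticalClique {V : Type*} (G : SimpleGraph V) (S : Set V) : Prop :=
  Maximal (fun K : Set V => G.IsClique K ∧ IsModule G K) S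

/-- The join composition `(G₁, S₁) ⊗ (G₂, S₂)`, on the disjoint union of the vertex sets: the
edges of `G₁`, the edges of `G₂`, and all edges between `S₁` and `S₂`. -/
def joinComposition {V₁ V₂ : Type*} (G₁ : SimpleGraph V₁) (S₁ : Set V₁)
    (G₂ : SimpleGraph V₂) (S₂ : Set V₂) : SimpleGraph (V₁ ⊕ V₂) where
  Adj
    | .inl x, .inl y => G₁.Adj x y
    | .inr x, .inr y => G₂.Adj x y
    | .inl x, .inr y => x ∈ S₁ ∧ y ∈ S₂
    | .inr y, .inl x => x ∈ S₁ ∧ y ∈ S₂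
  symm := ⟨by
    rintro (x | x) (y | y) h
    · exact G₁.adj_symm h
    · exact h
    · exact h
    · exact G₂.adj_symm h⟩
  loopless := ⟨by
    rintro (x | x) h
    · exact G₁.irrefl h
    · exact G₂.irrefl h⟩

end LeafPower

/-! A connected graph is a 3-leaf power exactly when it is a blow-up of a tree by nonempty cliques
(`IsTreeBlowup`). Send each leaf to its parent: two leaves are within distance three iff their
parents are equal or adjacent. Conversely, hang a pendant vertex on the tree for each graph vertex.
In a non-complete graph the fibres of a blow-up are critical cliques; in a complete graph any
nonempty set is a fibre of a suitable blow-up (`exists_isTreeBlowup_fiber`).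

Sufficiency: under condition 1 both attachment sets are fibres, and joining the two trees by an edge
at these nodes gives a blow-up. Under condition 2, all of `V₂` is put into the fibre of `v`.

Necessity: take a blow-up map `f` of the composition and compare the images of the two sides. If
they are disjoint, acyclicity forces each attachment set to be a fibre, hence condition 1. If `f a =
f b` with `a` on the left and `b` on the right, then the attachment sets are the closed
neighbourhoods of `a` and `b`. When one of them is not its whole side, excluding triangles makes the
other side a clique contained in its attachment set; when both are whole, excluding 4-cycles makes
one a clique. Either way condition 2 holds. -/

namespace LeafPower

/-! ### Reachability, acyclicity and short distances in trees -/

section Acyclic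

variable {V U : Type*} {G : SimpleGraph V} {T : SimpleGraph U}

/-- A map sending adjacent vertices to equal or adjacent vertices preserves reachability. -/
theorem reachable_map {f : V → U} (h : ∀ x y, G.Adj x y → f x = f y ∨ T.Adj (f x) (f y)) {x y : V}
    (hxy : G.Reachable x y) : T.Reachable (f x) (f y) := by
  obtain ⟨p⟩ := hxy
  induction p with
  | nil => exact .rfl
  | cons hadj _ ih =>
    rcases h _ _ hadj with h | h
    · rwa [h]
    · exact h.reachable.trans ih

theorem not_reachable_deleteEdges (hT : T.IsAcyclic) {a b : U} (hab : T.Adj a b) :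
    ¬ (T.deleteEdges {s(a, b)}).Reachable a b :=
  SimpleGraph.isBridge_iff.1 (SimpleGraph.isAcyclic_iff_forall_adj_isBridge.1 hT hab)

theorem isAcyclic_of_not_reachable
    (h : ∀ a b, T.Adj a b → ¬ (T.deleteEdges {s(a, b)}).Reachable a b) : T.IsAcyclic :=
  SimpleGraph.isAcyclic_iff_forall_adj_isBridge.2 fun a b hab =>
    SimpleGraph.isBridge_iff.2 (h a b hab)

theorem not_triangle (hT : T.IsAcyclic) {a b c : U} (hab : T.Adj a b) (hac : T.Adj a c)
    (hcb : T.Adj c b) : False := by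
  refine not_reachable_deleteEdges hT hab (.trans (v := c) ?_ ?_) <;>
  · refine SimpleGraph.Adj.reachable ?_
    rw [SimpleGraph.deleteEdges_adj, Set.mem_singleton_iff, Sym2.eq_iff]
    have := hac.ne
    have := hcb.ne
    grind

theorem not_four_cycle (hT : T.IsAcyclic) {a b c d : U} (hab : T.Adj a b) (hbc : T.Adj b c)
    (hcd : T.Adj c d) (hda : T.Adj d a) (hac : a ≠ c) (hbd : b ≠ d) : False := by
  refine not_reachable_deleteEdges hT hab (.trans (v := d) ?_ (.trans (v := c) ?_ ?_)) <;>
  · refine SimpleGraph.Adj.reachable ?_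
    rw [SimpleGraph.deleteEdges_adj, Set.mem_singleton_iff, Sym2.eq_iff]
    have := hbc.ne
    have := hda.ne
    have := hbc.symm
    have := hcd.symm
    have := hda.symm
    grind

/-- If every `a`-incident edge goes to `p` and every `b`-incident edge goes to `q`, a path from `a`
to `b` of length at most three runs through `p` and `q`. -/
theorem dist_le_three_iff (hT : T.Connected) {a b p q : U} (ha : ∀ w, T.Adj a w ↔ w = p)
    (hb : ∀ w, T.Adj b w ↔ w = q) (hab : a ≠ b) (hnadj : ¬ T.Adj a b) :
    T.dist a b ≤ 3 ↔ p = q ∨ T.Adj p q := by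
  have hap : T.Adj a p := (ha p).2 rfl
  have hqb : T.Adj q b := ((hb q).2 rfl).symm
  constructor
  · intro h
    obtain ⟨w, hw⟩ := hT.exists_walk_length_eq_dist a b
    rw [← hw] at h
    cases w with
    | nil => exact absurd rfl hab
    | cons h₁ w =>
      obtain rfl := (ha _).1 h₁
      cases w with
      | nil => exact absurd h₁ hnadj
      | cons h₂ w =>
        cases w with
        | nil => exact .inl ((hb _).1 h₂.symm)
        | cons h₃ w =>
          cases w with
          | nil =>
            obtain rfl := (hb _).1 h₃.symm
            exact .inr h₂
          | cons h₄ w =>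
            simp only [SimpleGraph.Walk.length_cons] at h
            omega
  · rintro (rfl | h)
    · exact (SimpleGraph.dist_le (.cons hap (.cons hqb .nil))).trans (by simp)
    · exact (SimpleGraph.dist_le (.cons hap (.cons h (.cons hqb .nil)))).trans (by simp)

theorem connected_joinComposition {V₁ V₂ : Type*} {G₁ : SimpleGraph V₁} {G₂ : SimpleGraph V₂}
    {S₁ : Set V₁} {S₂ : Set V₂} (h₁ : G₁.Connected) (h₂ : G₂.Connected) (hS₁ : S₁.Nonempty)
    (hS₂ : S₂.Nonempty) : (joinComposition G₁ S₁ G₂ S₂).Connected := by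
  obtain ⟨a₁, ha₁⟩ := hS₁
  obtain ⟨a₂, ha₂⟩ := hS₂
  rw [SimpleGraph.connected_iff_exists_forall_reachable]
  have hadj : (joinComposition G₁ S₁ G₂ S₂).Adj (.inl a₁) (.inr a₂) := ⟨ha₁, ha₂⟩
  refine ⟨.inl a₁, ?_⟩
  rintro (x | x)
  · exact reachable_map (f := Sum.inl) (fun _ _ h => .inr h) (h₁ a₁ x)
  · exact hadj.reachable.trans (reachable_map (f := Sum.inr) (fun _ _ h => .inr h) (h₂ a₂ x))

/-- Joining two trees by an edge gives a tree. -/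
theorem isTree_joinComposition {V₁ V₂ : Type*} {T₁ : SimpleGraph V₁} {T₂ : SimpleGraph V₂}
    (h₁ : T₁.IsTree) (h₂ : T₂.IsTree) (a₁ : V₁) (a₂ : V₂) :
    (joinComposition T₁ {a₁} T₂ {a₂}).IsTree := by
  refine ⟨connected_joinComposition h₁.connected h₂.connected ⟨a₁, rfl⟩ ⟨a₂, rfl⟩,
    isAcyclic_of_not_reachable ?_⟩
  · have key : ∀ (x : V₁) (y : V₂), x = a₁ → y = a₂ →
        ¬ ((joinComposition T₁ {a₁} T₂ {a₂}).deleteEdges {s(.inl x, .inr y)}).Reachable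
          (.inl x) (.inr y) := by
      rintro x y rfl rfl hreach
      -- Once the joining edge is deleted, the side of a vertex is constant along edges.
      have := reachable_map (T := (⊥ : SimpleGraph Bool)) (f := Sum.isLeft) ?_ hreach
      · simp at this
      · rintro (u | u) (w | w) h <;> rw [SimpleGraph.deleteEdges_adj] at h
        · exact .inl rfl
        · obtain ⟨⟨rfl, rfl⟩, h⟩ := h
          exact absurd rfl h
        · obtain ⟨⟨rfl, rfl⟩, h⟩ := h
          exact absurd Sym2.eq_swap h
        · exact .inl rfl
    rintro (x | x) (y | y) hxy
    · intro hreach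
      refine not_reachable_deleteEdges h₁.isAcyclic (a := x) (b := y) hxy ?_
      -- Collapsing the second tree onto `a₁` turns a detour around the edge into one inside the
      -- first tree.
      refine reachable_map (f := Sum.elim id fun _ => a₁) ?_ hreach
      rintro (u | u) (w | w) h <;> rw [SimpleGraph.deleteEdges_adj] at h
      · refine .inr (SimpleGraph.deleteEdges_adj.2 ⟨h.1, ?_⟩)
        simpa using h.2
      · exact .inl h.1.1
      · exact .inl h.1.1.symm
      · exact .inl rfl
    · exact key x y hxy.1 hxy.2
    · rw [Sym2.eq_swap, SimpleGraph.reachable_comm]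
      exact key y x hxy.1 hxy.2
    · intro hreach
      refine not_reachable_deleteEdges h₂.isAcyclic (a := x) (b := y) hxy ?_
      refine reachable_map (f := Sum.elim (fun _ => a₂) id) ?_ hreach
      rintro (u | u) (w | w) h <;> rw [SimpleGraph.deleteEdges_adj] at h
      · exact .inl rfl
      · exact .inl h.1.2.symm
      · exact .inl h.1.2
      · refine .inr (SimpleGraph.deleteEdges_adj.2 ⟨h.1, ?_⟩)
        simpa using h.2

end Acyclic

/-! ### Tree blow-ups and 3-leaf powers -/

/-- `G` is obtained from the tree `T` by substituting the cliques `f ⁻¹' {u}` for its vertices. -/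
structure IsTreeBlowup {V U : Type*} (G : SimpleGraph V) (T : SimpleGraph U) (f : V → U) :
    Prop where
  isTree : T.IsTree
  surjective : Function.Surjective f
  adj_iff : ∀ {x y}, x ≠ y → (G.Adj x y ↔ f x = f y ∨ T.Adj (f x) (f y))

/-- The tree `T` with a pendant vertex attached to `f x` for every `x`. -/
def pendantTree {V U : Type*} (T : SimpleGraph U) (f : V → U) : SimpleGraph (U ⊕ V) where
  Adj
    | .inl u, .inl w => T.Adj u w
    | .inl u, .inr x => u = f x
    | .inr x, .inl u => u = f x
    | .inr _, .inr _ => False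
  symm := ⟨by
    rintro (x | x) (y | y) h
    · exact T.adj_symm h
    · exact h
    · exact h
    · exact h⟩
  loopless := ⟨by
    rintro (x | x) h
    · exact T.irrefl h
    · exact h⟩

section PendantTree

variable {V U : Type*} {G : SimpleGraph V} {T : SimpleGraph U} {f : V → U}

theorem pendantTree_adj_inr (x : V) (w : U ⊕ V) :
    (pendantTree T f).Adj (.inr x) w ↔ w = .inl (f x) := by
  rcases w with w | w
  · exact Sum.inl_injective.eq_iff.symm
  · exact iff_of_false id (by simp)

theorem isTree_pendantTree (hT : T.IsTree) (f : V → U) : (pendantTree T f).IsTree := by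
  have hl : ∀ u w, (pendantTree T f).Reachable (.inl u) (.inl w) := fun u w =>
    reachable_map (f := Sum.inl) (fun _ _ h => .inr h) (hT.connected u w)
  refine ⟨?_, isAcyclic_of_not_reachable ?_⟩
  · obtain ⟨u⟩ := hT.connected.nonempty
    rw [SimpleGraph.connected_iff_exists_forall_reachable]
    refine ⟨.inl u, ?_⟩
    rintro (x | x)
    · exact hl u x
    · exact (hl u (f x)).trans (SimpleGraph.Adj.reachable rfl)
  · have key : ∀ x : V, ¬ ((pendantTree T f).deleteEdges {s(.inr x, .inl (f x))}).Reachable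
        (.inr x) (.inl (f x)) := by
      rintro x ⟨p⟩
      cases p with
      | cons h p =>
        rw [SimpleGraph.deleteEdges_adj, pendantTree_adj_inr] at h
        obtain ⟨rfl, h⟩ := h
        exact h rfl
    rintro (x | x) (y | y) hxy
    · intro hreach
      refine not_reachable_deleteEdges hT.isAcyclic (a := x) (b := y) hxy ?_
      refine reachable_map (f := Sum.elim id f) ?_ hreach
      rintro (u | u) (w | w) h <;> rw [SimpleGraph.deleteEdges_adj] at h
      · refine .inr (SimpleGraph.deleteEdges_adj.2 ⟨h.1, ?_⟩)
        simpa using h.2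
      · exact .inl h.1
      · exact .inl (Eq.symm h.1)
      · exact h.1.elim
    · obtain rfl : x = f y := hxy
      rw [Sym2.eq_swap, SimpleGraph.reachable_comm]
      exact key y
    · obtain rfl : y = f x := hxy
      exact key x
    · exact hxy.elim

/-- A node `f x` carries the pendant vertex of `x` and has a second neighbour: given `y ≠ x`, either
`y` hangs there too, or `T` is nontrivial and supplies one. With a single graph vertex, the node
would itself be a leaf. -/
theorem isLeaf_pendantTree_iff [Nontrivial V] (hT : T.IsTree) (hf : Function.Surjective f)
    (w : U ⊕ V) : IsLeaf (pendantTree T f) w ↔ ∃ x, w = .inr x := by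
  constructor
  · rcases w with u | x
    · intro h
      exfalso
      obtain ⟨x, rfl⟩ := hf u
      obtain ⟨y, hy⟩ := exists_ne x
      by_cases hxy : f x = f y
      · have := h (show Sum.inr x ∈ _ from rfl) (show Sum.inr y ∈ _ from hxy)
        exact hy (Sum.inr_injective this).symm
      · have : Nontrivial U := ⟨f x, f y, hxy⟩
        obtain ⟨w, hw⟩ := hT.connected.preconnected.exists_adj_of_nontrivial (f x)
        exact Sum.inr_ne_inl (h (show Sum.inr x ∈ _ from rfl) (show Sum.inl w ∈ _ from hw))
    · exact fun _ => ⟨x, rfl⟩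
  · rintro ⟨x, rfl⟩ a ha b hb
    rw [SimpleGraph.mem_neighborSet, pendantTree_adj_inr] at ha hb
    rw [ha, hb]

theorem dist_pendantTree_le_three_iff (hT : T.IsTree) {x y : V} (hxy : x ≠ y) :
    (pendantTree T f).dist (.inr x) (.inr y) ≤ 3 ↔ f x = f y ∨ T.Adj (f x) (f y) := by
  rw [dist_le_three_iff (isTree_pendantTree hT f).connected (pendantTree_adj_inr x)
    (pendantTree_adj_inr y) (Sum.inr_injective.ne hxy) id, Sum.inl_injective.eq_iff]
  exact Iff.rfl

end PendantTree

theorem IsLeafPower.of_iso {V V' : Type*} {G : SimpleGraph V} {G' : SimpleGraph V'} {k : ℕ}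
    (e : G ≃g G') (h : IsLeafPower G' k) : IsLeafPower G k := by
  obtain ⟨W, hW, T, hT, ⟨e'⟩⟩ := h
  exact ⟨W, hW, T, hT, ⟨e.trans e'⟩⟩

namespace IsTreeBlowup

variable {V : Type*} {G : SimpleGraph V}

theorem comp_iso {V' U : Type*} {G' : SimpleGraph V'} {T : SimpleGraph U} {f : V → U}
    (h : IsTreeBlowup G T f) (e : G' ≃g G) : IsTreeBlowup G' T (f ∘ e) where
  isTree := h.isTree
  surjective := h.surjective.comp e.surjective
  adj_iff {x y} hxy := by
    rw [← e.map_adj_iff, h.adj_iff (e.injective.ne hxy)]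
    rfl

theorem isLeafPower_of_type {V U : Type} [Finite V] {G : SimpleGraph V} {T : SimpleGraph U}
    {f : V → U} (h : IsTreeBlowup G T f) : IsLeafPower G 3 := by
  have : Finite U := Finite.of_surjective f h.surjective
  cases subsingleton_or_nontrivial V with
  | inl _ =>
    obtain ⟨u⟩ := h.isTree.connected.nonempty
    obtain ⟨x, -⟩ := h.surjective u
    have : Nonempty V := ⟨x⟩
    have hleaf : ∀ w : V, IsLeaf G w := fun w => Set.subsingleton_of_subsingleton
    refine ⟨V, inferInstance, G, .of_subsingleton, ⟨⟨⟨fun x => ⟨x, hleaf x⟩, fun w => w.1,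
      fun _ => rfl, fun _ => rfl⟩, ?_⟩⟩⟩
    intro a b
    obtain rfl := Subsingleton.elim a b
    simp
  | inr _ =>
    refine ⟨U ⊕ V, inferInstance, pendantTree T f, isTree_pendantTree h.isTree f, ⟨?_⟩⟩
    have hleaf := isLeaf_pendantTree_iff h.isTree h.surjective
    refine ⟨Equiv.ofBijective (fun x => ⟨.inr x, (hleaf _).2 ⟨x, rfl⟩⟩) ⟨?_, ?_⟩, ?_⟩
    · intro x y hxy
      exact Sum.inr_injective (congrArg Subtype.val hxy)
    · rintro ⟨w, hw⟩
      obtain ⟨x, rfl⟩ := (hleaf w).1 hw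
      exact ⟨x, rfl⟩
    · intro x y
      by_cases hxy : x = y
      · subst hxy
        simp
      · rw [h.adj_iff hxy, ← dist_pendantTree_le_three_iff h.isTree hxy]
        refine ⟨fun h => h.2, fun h => ⟨fun h' => hxy ?_, h⟩⟩
        exact Sum.inr_injective (congrArg Subtype.val h')

/-- `IsLeafPower` asks for a tree in `Type`, so a vertex set in another universe is first replaced
by `Fin n`. -/
theorem isLeafPower [Finite V] {U : Type} {T : SimpleGraph U} {f : V → U}
    (h : IsTreeBlowup G T f) : IsLeafPower G 3 := by
  obtain ⟨n, ⟨e⟩⟩ := Finite.exists_equiv_fin V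
  let i : G.comap e.symm ≃g G := SimpleGraph.Iso.comap e.symm G
  exact .of_iso i.symm (h.comp_iso i).isLeafPower_of_type

theorem of_isClique_univ [Nonempty V] (h : G.IsClique Set.univ) :
    IsTreeBlowup G (⊥ : SimpleGraph Unit) fun _ => () where
  isTree := .of_subsingleton
  surjective := fun _ => ⟨Classical.arbitrary V, rfl⟩
  adj_iff hxy := iff_of_true (h trivial trivial hxy) (.inl rfl)

end IsTreeBlowup

/-- A connected 3-leaf power is a blow-up of a tree by cliques. -/
theorem IsLeafPower.exists_isTreeBlowup {V : Type*} {G : SimpleGraph V} (hG : G.Connected)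
    (h : IsLeafPower G 3) :
    ∃ (U : Type) (T : SimpleGraph U) (f : V → U), IsTreeBlowup G T f := by
  have := hG.nonempty
  by_cases hcl : G.IsClique Set.univ
  · exact ⟨_, _, _, .of_isClique_univ hcl⟩
  obtain ⟨W, hW, T, hT, ⟨e⟩⟩ := h
  have hadj : ∀ x y, x ≠ y → (G.Adj x y ↔ T.dist (e x).1 (e y).1 ≤ 3) := fun x y hxy => by
    rw [← e.map_adj_iff]
    exact ⟨fun h => h.2, fun h => ⟨e.injective.ne hxy, h⟩⟩
  have hval : ∀ {x y}, x ≠ y → (e x).1 ≠ (e y).1 := fun hxy h =>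
    hxy (e.injective (Subtype.ext h))
  obtain ⟨x₀, y₀, hne, hnadj⟩ : ∃ x y, x ≠ y ∧ ¬ G.Adj x y := by
    simp only [SimpleGraph.IsClique, Set.Pairwise] at hcl
    push Not at hcl
    obtain ⟨x, -, y, -, h⟩ := hcl
    exact ⟨x, y, h⟩
  have : Nontrivial W := ⟨_, _, hval hne⟩
  have hpar : ∀ x, ∃ p, ∀ w, T.Adj (e x).1 w ↔ w = p := fun x => by
    obtain ⟨p, hp⟩ := hT.connected.preconnected.exists_adj_of_nontrivial (e x).1
    refine ⟨p, fun w => ⟨fun hw => (e x).2 hw hp, ?_⟩⟩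
    rintro rfl
    exact hp
  choose f hf using hpar
  have hleaf : ∀ x y, ¬ T.Adj (e x).1 (e y).1 := by
    intro x y hxy
    -- Two adjacent leaves form a closed component, hence the whole tree; then `x₀` and `y₀` would
    -- be adjacent in `G`.
    have hstep : ∀ w, w = (e x).1 ∨ w = (e y).1 := by
      intro w
      have := reachable_map (T := (⊥ : SimpleGraph Prop))
        (f := fun w => w = (e x).1 ∨ w = (e y).1) ?_ (hT.connected (e x).1 w)
      · rw [SimpleGraph.reachable_bot] at this
        simpa using this
      · have hmem : ∀ a b, T.Adj a b → (a = (e x).1 ∨ a = (e y).1) →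
            (b = (e x).1 ∨ b = (e y).1) := by
          rintro a b hab (rfl | rfl)
          · exact .inr ((e x).2 hab hxy)
          · exact .inl ((e y).2 hab hxy.symm)
        intro a b hab
        exact .inl (propext ⟨hmem a b hab, hmem b a hab.symm⟩)
    refine hnadj ((hadj x₀ y₀ hne).2 ?_)
    have hd : T.dist (e x).1 (e y).1 ≤ 3 := by
      rw [SimpleGraph.dist_eq_one_iff_adj.2 hxy]
      omega
    have hv := hval hne
    rcases hstep (e x₀).1 with h | h <;> rcases hstep (e y₀).1 with h' | h' <;> rw [h, h'] at hv ⊢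
    · exact absurd rfl hv
    · exact hd
    · rwa [SimpleGraph.dist_comm]
    · exact absurd rfl hv
  have hiff : ∀ {x y}, x ≠ y → (G.Adj x y ↔ f x = f y ∨ T.Adj (f x) (f y)) := fun {x y} hxy => by
    rw [hadj x y hxy, dist_le_three_iff hT.connected (hf x) (hf y) (hval hxy) (hleaf x y)]
  refine ⟨Set.range f, T.induce (Set.range f), Set.rangeFactorization f, ⟨?_, ?_⟩,
    Set.rangeFactorization_surjective, ?_⟩
  · rw [SimpleGraph.connected_iff_exists_forall_reachable]
    refine ⟨Set.rangeFactorization f x₀, ?_⟩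
    rintro ⟨_, y, rfl⟩
    -- The parents span a connected subtree because `f` maps walks of the connected graph `G` to
    -- walks among parents.
    refine reachable_map (f := Set.rangeFactorization f) ?_ (hG x₀ y)
    intro a b hab
    exact ((hiff hab.ne).1 hab).imp Subtype.ext id
  · exact hT.isAcyclic.induce _
  · intro x y hxy
    rw [hiff hxy]
    exact or_congr_left (Set.rangeFactorization_eq_rangeFactorization_iff _ _).symm

/-! ### Fibres and critical cliques -/

section CriticalClique

variable {V U : Type*} {G : SimpleGraph V} {T : SimpleGraph U} {f : V → U}

/-- Twins in different fibres of a tree blow-up only exist in complete graphs. -/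
theorem IsTreeBlowup.isClique_univ_of_twins (h : IsTreeBlowup G T f) (hG : G.Connected) {x y : V}
    (hxy : f x ≠ f y) (hadj : G.Adj x y) (htwin : ∀ z, z ≠ x → z ≠ y → (G.Adj x z ↔ G.Adj y z)) :
    G.IsClique Set.univ := by
  have hT : T.Adj (f x) (f y) := ((h.adj_iff hadj.ne).1 hadj).resolve_left hxy
  -- An edge leaving the two fibres would end at a node adjacent to one of `f x`, `f y`, hence by
  -- twinship to both: a triangle in `T`. So these fibres exhaust the connected graph.
  have hmem : ∀ a b, G.Adj a b → (f a = f x ∨ f a = f y) → (f b = f x ∨ f b = f y) := by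
    intro a b hab ha
    by_contra hb
    push Not at hb
    have hbx : b ≠ x := fun h => hb.1 (congrArg f h)
    have hby : b ≠ y := fun h => hb.2 (congrArg f h)
    have hfab := ((h.adj_iff hab.ne).1 hab)
    have hxb : G.Adj x b ↔ T.Adj (f x) (f b) := by
      rw [h.adj_iff hbx.symm, or_iff_right hb.1.symm]
    have hyb : G.Adj y b ↔ T.Adj (f y) (f b) := by
      rw [h.adj_iff hby.symm, or_iff_right hb.2.symm]
    have htw := htwin b hbx hby
    rw [hxb, hyb] at htw
    have : T.Adj (f x) (f b) := by
      rcases ha with ha | ha <;> rw [ha] at hfab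
      · exact hfab.resolve_left hb.1.symm
      · exact htw.2 (hfab.resolve_left hb.2.symm)
    exact not_triangle h.isTree.isAcyclic this hT (htw.1 this)
  have hall : ∀ a, f a = f x ∨ f a = f y := fun a => by
    have := reachable_map (T := (⊥ : SimpleGraph Prop))
      (f := fun a => f a = f x ∨ f a = f y) (fun a b hab =>
        .inl (propext ⟨hmem a b hab, hmem b a hab.symm⟩)) (hG x a)
    rw [SimpleGraph.reachable_bot] at this
    simpa using this
  intro a _ b _ hab
  rw [h.adj_iff hab]
  rcases hall a with ha | ha <;> rcases hall b with hb | hb <;> rw [ha, hb]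
  · exact .inl rfl
  · exact .inr hT
  · exact .inr hT.symm
  · exact .inl rfl

/-- In a non-complete tree blow-up, a clique that is a module lies in one fibre. -/
theorem IsTreeBlowup.eq_of_mem_module (h : IsTreeBlowup G T f) (hG : G.Connected)
    (hnc : ¬ G.IsClique Set.univ) {K : Set V} (hK : G.IsClique K) (hm : IsModule G K) {x y : V}
    (hx : x ∈ K) (hy : y ∈ K) : f x = f y := by
  by_contra hne
  have hxy : x ≠ y := fun h => hne (congrArg f h)
  refine hnc (h.isClique_univ_of_twins hG hne (hK hx hy hxy) fun z hzx hzy => ?_)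
  by_cases hz : z ∈ K
  · exact iff_of_true (hK hx hz hzx.symm) (hK hy hz hzy.symm)
  · have := Set.ext_iff.1 (hm x hx y hy) z
    simpa [hz] using this

theorem IsTreeBlowup.isClique_fiber (h : IsTreeBlowup G T f) (u : U) : G.IsClique (f ⁻¹' {u}) := by
  intro x hx y hy hxy
  rw [h.adj_iff hxy]
  exact .inl (Eq.trans hx (Eq.symm hy))

theorem IsTreeBlowup.isModule_fiber (h : IsTreeBlowup G T f) (u : U) : IsModule G (f ⁻¹' {u}) := by
  rintro x rfl y hy
  have hy : f y = f x := hy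
  ext z
  refine and_congr_left fun hz => ?_
  rw [SimpleGraph.mem_neighborSet, SimpleGraph.mem_neighborSet,
    h.adj_iff fun h => hz (congrArg f h.symm),
    h.adj_iff fun h => hz ((congrArg f h.symm).trans hy), hy]

theorem IsTreeBlowup.isCriticalClique_fiber (h : IsTreeBlowup G T f) (hG : G.Connected)
    (hnc : ¬ G.IsClique Set.univ) (u : U) : IsCriticalClique G (f ⁻¹' {u}) := by
  refine ⟨⟨h.isClique_fiber u, h.isModule_fiber u⟩, fun K hK hle y hy => ?_⟩
  obtain ⟨x, rfl⟩ := h.surjective u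
  exact h.eq_of_mem_module hG hnc hK.1 hK.2 hy (hle rfl)

/-- A critical clique, or any nonempty set of vertices of a complete graph, is a fibre of some tree
blow-up. -/
theorem exists_isTreeBlowup_fiber (hG : G.Connected) (h : IsLeafPower G 3) {S : Set V}
    (hS : S.Nonempty) (hcrit : ¬ IsCriticalClique G S → G.IsClique Set.univ) :
    ∃ (U : Type) (T : SimpleGraph U) (f : V → U) (u : U), IsTreeBlowup G T f ∧ S = f ⁻¹' {u} := by
  classical
  have := hG.nonempty
  by_cases hcl : G.IsClique Set.univ
  · by_cases huniv : S = Set.univ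
    · exact ⟨_, _, _, (), .of_isClique_univ hcl, by simp [huniv]⟩
    · obtain ⟨x, hx⟩ := hS
      obtain ⟨y, hy⟩ := (Set.ne_univ_iff_exists_notMem S).1 huniv
      -- A complete graph is the blow-up of a single edge with fibres `S` and its complement.
      refine ⟨Bool, ⊤, fun z => decide (z ∈ S), true, ⟨⟨SimpleGraph.connected_top,
        .of_card_le_two (by simp)⟩, ?_, ?_⟩, by ext; simp⟩
      · rintro (_ | _)
        · exact ⟨y, by simpa using hy⟩
        · exact ⟨x, by simpa using hx⟩
      · intro a b hab
        exact iff_of_true (hcl trivial trivial hab) (by rw [SimpleGraph.top_adj]; exact em _)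
  · obtain ⟨U, T, f, hf⟩ := h.exists_isTreeBlowup hG
    have hc : IsCriticalClique G S := not_not.1 fun h => hcl (hcrit h)
    obtain ⟨x, hx⟩ := hS
    have hle : S ⊆ f ⁻¹' {f x} := fun y hy =>
      hf.eq_of_mem_module hG hcl hc.1.1 hc.1.2 hy hx
    exact ⟨U, T, f, f x, hf, hle.antisymm
      (hc.2 ⟨hf.isClique_fiber _, hf.isModule_fiber _⟩ hle)⟩

end CriticalClique

/-! ### Blow-ups of join compositions -/

section Join

variable {V₁ V₂ : Type*} {G₁ : SimpleGraph V₁} {G₂ : SimpleGraph V₂} {S₁ : Set V₁} {S₂ : Set V₂}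

/-- Exchanging the two sides of a join composition. -/
def joinCompositionSwap (G₁ : SimpleGraph V₁) (S₁ : Set V₁) (G₂ : SimpleGraph V₂) (S₂ : Set V₂) :
    joinComposition G₁ S₁ G₂ S₂ ≃g joinComposition G₂ S₂ G₁ S₁ where
  toEquiv := Equiv.sumComm V₁ V₂
  map_rel_iff' := by
    rintro (x | x) (y | y)
    · exact Iff.rfl
    · exact and_comm
    · exact and_comm
    · exact Iff.rfl

theorem IsTreeBlowup.join_of_fibers {U₁ U₂ : Type*} {T₁ : SimpleGraph U₁} {T₂ : SimpleGraph U₂}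
    {f₁ : V₁ → U₁} {f₂ : V₂ → U₂} (h₁ : IsTreeBlowup G₁ T₁ f₁) (h₂ : IsTreeBlowup G₂ T₂ f₂)
    (u₁ : U₁) (u₂ : U₂) :
    IsTreeBlowup (joinComposition G₁ (f₁ ⁻¹' {u₁}) G₂ (f₂ ⁻¹' {u₂}))
      (joinComposition T₁ {u₁} T₂ {u₂}) (Sum.map f₁ f₂) where
  isTree := isTree_joinComposition h₁.isTree h₂.isTree u₁ u₂
  surjective := h₁.surjective.sumMap h₂.surjective
  adj_iff {x y} hxy := by
    rcases x with x | x <;> rcases y with y | y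
    · exact (h₁.adj_iff fun h => hxy (congrArg _ h)).trans
        (or_congr_left Sum.inl_injective.eq_iff.symm)
    · exact (or_iff_right Sum.inl_ne_inr).symm
    · exact (or_iff_right Sum.inr_ne_inl).symm
    · exact (h₂.adj_iff fun h => hxy (congrArg _ h)).trans
        (or_congr_left Sum.inr_injective.eq_iff.symm)

theorem IsTreeBlowup.join_closed_neighborhood {U : Type*} {T : SimpleGraph U} {f : V₁ → U}
    (h : IsTreeBlowup G₁ T f) (v : V₁) (hcl : G₂.IsClique Set.univ) :
    IsTreeBlowup (joinComposition G₁ (insert v (G₁.neighborSet v)) G₂ Set.univ) T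
      (Sum.elim f fun _ => f v) where
  isTree := h.isTree
  surjective u := by
    obtain ⟨x, rfl⟩ := h.surjective u
    exact ⟨.inl x, rfl⟩
  adj_iff {x y} hxy := by
    have key : ∀ x, x ∈ insert v (G₁.neighborSet v) ↔ f x = f v ∨ T.Adj (f x) (f v) := by
      intro x
      rw [Set.mem_insert_iff, SimpleGraph.mem_neighborSet, SimpleGraph.adj_comm]
      by_cases hx : x = v
      · subst hx
        simp
      · rw [or_iff_right hx, h.adj_iff hx]
    rcases x with x | x <;> rcases y with y | y
    · exact h.adj_iff fun h => hxy (congrArg _ h)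
    · exact (and_iff_left trivial).trans (key x)
    · refine (and_iff_left trivial).trans ((key y).trans ?_)
      rw [eq_comm, SimpleGraph.adj_comm]
      exact Iff.rfl
    · exact iff_of_true (hcl trivial trivial fun h => hxy (congrArg _ h)) (.inl rfl)

/-! ### Necessity: the position of the two sides in the tree -/

section Analysis

variable {U : Type*} {T : SimpleGraph U} {f : V₁ ⊕ V₂ → U}

theorem IsTreeBlowup.adj_left (h : IsTreeBlowup (joinComposition G₁ S₁ G₂ S₂) T f) {x y : V₁}
    (hxy : x ≠ y) : G₁.Adj x y ↔ f (.inl x) = f (.inl y) ∨ T.Adj (f (.inl x)) (f (.inl y)) :=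
  h.adj_iff (Sum.inl_injective.ne hxy)

theorem IsTreeBlowup.adj_right (h : IsTreeBlowup (joinComposition G₁ S₁ G₂ S₂) T f) {x y : V₂}
    (hxy : x ≠ y) : G₂.Adj x y ↔ f (.inr x) = f (.inr y) ∨ T.Adj (f (.inr x)) (f (.inr y)) :=
  h.adj_iff (Sum.inr_injective.ne hxy)

theorem IsTreeBlowup.mem_and_mem_iff (h : IsTreeBlowup (joinComposition G₁ S₁ G₂ S₂) T f)
    (x : V₁) (y : V₂) :
    x ∈ S₁ ∧ y ∈ S₂ ↔ f (.inl x) = f (.inr y) ∨ T.Adj (f (.inl x)) (f (.inr y)) :=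
  h.adj_iff (x := .inl x) (y := .inr y) Sum.inl_ne_inr

/-- Since `b ∈ S₂`, membership in `S₁` means adjacency to `b`, and `a` occupies the same node as
`b`. -/
theorem IsTreeBlowup.eq_closed_neighborhood (h : IsTreeBlowup (joinComposition G₁ S₁ G₂ S₂) T f)
    {a : V₁} {b : V₂} (hab : f (.inl a) = f (.inr b)) : S₁ = insert a (G₁.neighborSet a) := by
  have hb : b ∈ S₂ := ((h.mem_and_mem_iff a b).2 (.inl hab)).2
  ext x
  rw [← and_iff_left (a := x ∈ S₁) hb, h.mem_and_mem_iff, ← hab, Set.mem_insert_iff,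
    SimpleGraph.mem_neighborSet, G₁.adj_comm]
  by_cases hx : x = a
  · subst hx
    simp
  · rw [or_iff_right hx, h.adj_left hx]

/-- If the two sides of a join composition overlap in the tree and the right side is not contained
in the attachment set, then the left side is a clique and is its own attachment set. -/
theorem IsTreeBlowup.isClique_left_of_overlap
    (h : IsTreeBlowup (joinComposition G₁ S₁ G₂ S₂) T f) (h₁ : G₁.Connected) (h₂ : G₂.Connected)
    {a : V₁} {b : V₂} (hab : f (.inl a) = f (.inr b)) (hS₂ : S₂ ≠ Set.univ) :
    S₁ = Set.univ ∧ G₁.IsClique S₁ := by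
  obtain ⟨haS, hbS⟩ := (h.mem_and_mem_iff a b).2 (.inl hab)
  obtain ⟨c, hc⟩ := (Set.ne_univ_iff_exists_notMem S₂).1 hS₂
  obtain ⟨y, hy, c, hc, hyc⟩ : ∃ y ∈ S₂, ∃ c ∉ S₂, G₂.Adj y c := by
    obtain ⟨p⟩ := h₂ b c
    obtain ⟨d, -, hd⟩ := p.exists_boundary_dart S₂ hbS hc
    exact ⟨_, hd.1, _, hd.2, d.adj⟩
  have hfyc := (h.adj_right hyc.ne).1 hyc
  -- If `y` shared a node with a left vertex, its neighbour `c` would be joined to that vertex,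
  -- forcing `c ∈ S₂`.
  have hne : ∀ x, f (.inr y) ≠ f (.inl x) := fun x hx => by
    rw [hx] at hfyc
    exact hc ((h.mem_and_mem_iff x c).2 hfyc).2
  -- Otherwise the nodes of `x`, `a` and `y` form a triangle.
  have hfib : ∀ x ∈ S₁, f (.inl x) = f (.inl a) := by
    intro x hx
    by_contra hxa
    have h1 := ((h.mem_and_mem_iff x b).1 ⟨hx, hbS⟩)
    rw [← hab] at h1
    exact not_triangle h.isTree.isAcyclic (h1.resolve_left hxa)
      (((h.mem_and_mem_iff x y).1 ⟨hx, hy⟩).resolve_left (hne x).symm)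
      (((h.mem_and_mem_iff a y).1 ⟨haS, hy⟩).resolve_left (hne a).symm).symm
  constructor
  · by_contra hS₁
    obtain ⟨d, hd⟩ := (Set.ne_univ_iff_exists_notMem S₁).1 hS₁
    obtain ⟨p⟩ := h₁ a d
    obtain ⟨⟨⟨x, d⟩, hxd⟩, -, hx, hd⟩ := p.exists_boundary_dart S₁ haS hd
    have := (h.adj_left (SimpleGraph.Adj.ne hxd)).1 hxd
    rw [hfib x hx, hab, eq_comm, SimpleGraph.adj_comm] at this
    exact hd ((h.mem_and_mem_iff d b).2 this).1
  · intro x hx y hy hxy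
    rw [h.adj_left hxy, hfib x hx, hfib y hy]
    exact .inl rfl

/-- At least one of the two attachment sets is a clique. -/
theorem IsTreeBlowup.isClique_or_isClique
    (h : IsTreeBlowup (joinComposition G₁ S₁ G₂ S₂) T f) : G₁.IsClique S₁ ∨ G₂.IsClique S₂ := by
  by_contra! hcon
  simp only [SimpleGraph.IsClique, Set.Pairwise] at hcon
  push Not at hcon
  obtain ⟨⟨x, hx, x', hx', hxne, hxx'⟩, y, hy, y', hy', hyne, hyy'⟩ := hcon
  rw [h.adj_left hxne, not_or] at hxx'
  rw [h.adj_right hyne, not_or] at hyy'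
  have hxy := (h.mem_and_mem_iff x y).1 ⟨hx, hy⟩
  have hxy' := (h.mem_and_mem_iff x y').1 ⟨hx, hy'⟩
  have hx'y := (h.mem_and_mem_iff x' y).1 ⟨hx', hy⟩
  have hx'y' := (h.mem_and_mem_iff x' y').1 ⟨hx', hy'⟩
  -- If a left and a right node coincided, the other left vertex would be adjacent to the first.
  have e1 : f (.inl x) ≠ f (.inr y) := fun e => by
    rw [← e, eq_comm, SimpleGraph.adj_comm] at hx'y
    exact hx'y.elim hxx'.1 hxx'.2
  have e2 : f (.inl x) ≠ f (.inr y') := fun e => by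
    rw [← e, eq_comm, SimpleGraph.adj_comm] at hx'y'
    exact hx'y'.elim hxx'.1 hxx'.2
  have e3 : f (.inl x') ≠ f (.inr y) := fun e => by
    rw [← e] at hxy
    exact hxy.elim hxx'.1 hxx'.2
  have e4 : f (.inl x') ≠ f (.inr y') := fun e => by
    rw [← e] at hxy'
    exact hxy'.elim hxx'.1 hxx'.2
  exact not_four_cycle h.isTree.isAcyclic (hxy.resolve_left e1) (hx'y.resolve_left e3).symm
    (hx'y'.resolve_left e4) (hxy'.resolve_left e2).symm hxx'.1 hyy'.1

/-- If the two sides do not overlap in the tree, the left attachment set is a fibre. -/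
theorem IsTreeBlowup.left_eq_fiber (h : IsTreeBlowup (joinComposition G₁ S₁ G₂ S₂) T f)
    (h₁ : G₁.Connected) (hdis : ∀ a b, f (.inl a) ≠ f (.inr b)) {x : V₁} {y : V₂} (hx : x ∈ S₁)
    (hy : y ∈ S₂) (x' : V₁) : x' ∈ S₁ ↔ f (.inl x') = f (.inl x) := by
  have hxy := ((h.mem_and_mem_iff x y).1 ⟨hx, hy⟩)
  constructor
  · intro hx'
    by_contra hne
    have hx'y := ((h.mem_and_mem_iff x' y).1 ⟨hx', hy⟩).resolve_left (hdis _ _)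
    -- A path from `x` to `x'` in `G₁` stays among left nodes, so with the edge from `x'` to `y` it
    -- bypasses the edge between `x` and `y`.
    refine not_reachable_deleteEdges h.isTree.isAcyclic (hxy.resolve_left (hdis _ _))
      (.trans (v := f (.inl x')) ?_ (SimpleGraph.Adj.reachable ?_))
    · refine reachable_map (f := fun z => f (.inl z)) (fun u w huw => ?_) (h₁ x x')
      refine ((h.adj_left huw.ne).1 huw).imp_right fun hT => SimpleGraph.deleteEdges_adj.2 ⟨hT, ?_⟩
      simp [hdis]
    · refine SimpleGraph.deleteEdges_adj.2 ⟨hx'y, ?_⟩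
      simp [hdis, hne]
  · intro he
    rw [← he] at hxy
    exact ((h.mem_and_mem_iff x' y).2 hxy).1

/-- If the two sides do not overlap in the tree, the left attachment set is a critical clique unless
the left graph is complete. -/
theorem IsTreeBlowup.left_of_disjoint (h : IsTreeBlowup (joinComposition G₁ S₁ G₂ S₂) T f)
    (h₁ : G₁.Connected) (hdis : ∀ a b, f (.inl a) ≠ f (.inr b)) (hS₁ : S₁.Nonempty)
    (hS₂ : S₂.Nonempty) :
    G₁.IsClique S₁ ∧ (¬ IsCriticalClique G₁ S₁ → G₁.IsClique Set.univ) := by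
  obtain ⟨x, hx⟩ := hS₁
  obtain ⟨y, hy⟩ := hS₂
  have hblow : IsTreeBlowup G₁ (T.induce (Set.range fun z : V₁ => f (.inl z)))
      (Set.rangeFactorization fun z => f (.inl z)) := by
    refine ⟨⟨?_, h.isTree.isAcyclic.induce _⟩, Set.rangeFactorization_surjective, ?_⟩
    · rw [SimpleGraph.connected_iff_exists_forall_reachable]
      refine ⟨Set.rangeFactorization _ x, ?_⟩
      rintro ⟨_, z, rfl⟩
      refine reachable_map (f := Set.rangeFactorization fun z : V₁ => f (.inl z)) ?_ (h₁ x z)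
      exact fun u w huw => ((h.adj_left huw.ne).1 huw).imp_left Subtype.ext
    · intro u w huw
      rw [h.adj_left huw]
      exact or_congr_left
        (Set.rangeFactorization_eq_rangeFactorization_iff (f := fun z => f (.inl z)) u w).symm
  have hS : S₁ = (Set.rangeFactorization fun z : V₁ => f (.inl z)) ⁻¹'
      {Set.rangeFactorization _ x} := by
    ext x'
    rw [h.left_eq_fiber h₁ hdis hx hy]
    exact (Set.rangeFactorization_eq_rangeFactorization_iff (f := fun z => f (.inl z)) x' x).symm
  rw [hS]
  exact ⟨hblow.isClique_fiber _, fun hn => by_contra fun hnc =>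
    hn (hblow.isCriticalClique_fiber h₁ hnc _)⟩

end Analysis

end Join

end LeafPower

theorem mainTheorem3 {V₁ V₂ : Type*} [Finite V₁] [Finite V₂]
    (G₁ : SimpleGraph V₁) (G₂ : SimpleGraph V₂)
    (hconn₁ : G₁.Connected) (hconn₂ : G₂.Connected)
    (hleaf₁ : LeafPower.IsLeafPower G₁ 3) (hleaf₂ : LeafPower.IsLeafPower G₂ 3)
    (S₁ : Set V₁) (S₂ : Set V₂) (hS₁ : S₁.Nonempty) (hS₂ : S₂.Nonempty) :
    LeafPower.IsLeafPower (LeafPower.joinComposition G₁ S₁ G₂ S₂) 3 ↔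
      (G₁.IsClique S₁ ∧ G₂.IsClique S₂ ∧
        (¬ LeafPower.IsCriticalClique G₁ S₁ → G₁.IsClique Set.univ) ∧
        (¬ LeafPower.IsCriticalClique G₂ S₂ → G₂.IsClique Set.univ)) ∨
      (∃ v : V₁, S₁ = insert v (G₁.neighborSet v) ∧ S₂ = Set.univ ∧ G₂.IsClique S₂) ∨
      (∃ v : V₂, S₂ = insert v (G₂.neighborSet v) ∧ S₁ = Set.univ ∧ G₁.IsClique S₁) := by
  constructor
  · intro h
    obtain ⟨U, T, f, hf⟩ := h.exists_isTreeBlowup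
      (LeafPower.connected_joinComposition hconn₁ hconn₂ hS₁ hS₂)
    have hf' := hf.comp_iso (LeafPower.joinCompositionSwap G₂ S₂ G₁ S₁)
    by_cases hov : ∃ a b, f (.inl a) = f (.inr b)
    · obtain ⟨a, b, hab⟩ := hov
      have ha := hf.eq_closed_neighborhood hab
      have hb := hf'.eq_closed_neighborhood (a := b) (b := a) hab.symm
      by_cases hu₂ : S₂ = Set.univ
      · by_cases hu₁ : S₁ = Set.univ
        · rcases hf.isClique_or_isClique with hc | hc
          · exact .inr (.inr ⟨b, hb, hu₁, hc⟩)
          · exact .inr (.inl ⟨a, ha, hu₂, hc⟩)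
        · obtain ⟨hu, hc⟩ :=
            hf'.isClique_left_of_overlap hconn₂ hconn₁ (a := b) (b := a) hab.symm hu₁
          exact .inr (.inl ⟨a, ha, hu, hc⟩)
      · obtain ⟨hu, hc⟩ := hf.isClique_left_of_overlap hconn₁ hconn₂ hab hu₂
        exact .inr (.inr ⟨b, hb, hu, hc⟩)
    · push Not at hov
      obtain ⟨hc₁, hcrit₁⟩ := hf.left_of_disjoint hconn₁ hov hS₁ hS₂
      obtain ⟨hc₂, hcrit₂⟩ := hf'.left_of_disjoint hconn₂ (fun b a => (hov a b).symm) hS₂ hS₁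
      exact .inl ⟨hc₁, hc₂, hcrit₁, hcrit₂⟩
  · rintro (⟨-, -, hcrit₁, hcrit₂⟩ | ⟨v, rfl, rfl, hcl⟩ | ⟨v, rfl, rfl, hcl⟩)
    · obtain ⟨U₁, T₁, f₁, u₁, hf₁, rfl⟩ :=
        LeafPower.exists_isTreeBlowup_fiber hconn₁ hleaf₁ hS₁ hcrit₁
      obtain ⟨U₂, T₂, f₂, u₂, hf₂, rfl⟩ :=
        LeafPower.exists_isTreeBlowup_fiber hconn₂ hleaf₂ hS₂ hcrit₂
      exact (hf₁.join_of_fibers hf₂ u₁ u₂).isLeafPower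
    · obtain ⟨U, T, f, hf⟩ := hleaf₁.exists_isTreeBlowup hconn₁
      exact (hf.join_closed_neighborhood v hcl).isLeafPower
    · obtain ⟨U, T, f, hf⟩ := hleaf₂.exists_isTreeBlowup hconn₂
      exact .of_iso (LeafPower.joinCompositionSwap _ _ _ _)
        (hf.join_closed_neighborhood v hcl).isLeafPower
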